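/- All graphs are finite, undirected and simple. A path decomposition of a graph $G$ is a collection of pairwise edge-disjoint paths in $G$ that covers all the edges of $G$; let $p(G)$ denote the minimum number of paths in a path decomposition of $G$. The Cartesian product $G\Box H$ is the graph with vertex set $V(G)\times V(H)$ in which $(u_1,v_1)$ and $(u_2,v_2)$ are adjacent if and only if either $u_1u_2\in E(G)$ and $v_1=v_2$, or $v_1v_2\in E(H)$ and $u_1=u_2$. Let $T$ be a tree of order (number of vertices) $m\geq 2$ and let $H$ be a connected graph of order $n$. Then $p(T\Box H)\leq \frac{mn}{2}$. -/

import Mathlib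

namespace SimpleGraph

/-- A subgraph of `G` is a path if it consists of the vertices and edges traversed by some walk
of `G` without repeated vertices. -/
def Subgraph.IsPathGraph {V : Type*} {G : SimpleGraph V} (P : G.Subgraph) : Prop :=
  ∃ (u v : V) (w : G.Walk u v), w.IsPath ∧ w.toSubgraph = P

/-- A path decomposition of `G`: a finite collection of pairwise edge-disjoint paths of `G` that
covers all the edges of `G`. -/
structure IsPathDecomposition {V : Type*} (G : SimpleGraph V) (D : Finset G.Subgraph) : Prop where
  isPath : ∀ P ∈ D, P.IsPathGraph
  edgeDisjoint : ∀ P ∈ D, ∀ Q ∈ D, P ≠ Q → Disjoint P.edgeSet Q.edgeSet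
  covers : ∀ e ∈ G.edgeSet, ∃ P ∈ D, e ∈ P.edgeSet

/-- `p(G)`: the minimum number of paths in a path decomposition of `G`. For a finite graph the
minimum is attained, see `isLeast_pathDecompositionNumber`. -/
noncomputable def pathDecompositionNumber {V : Type*} (G : SimpleGraph V) : ℕ :=
  sInf {k : ℕ | ∃ D : Finset G.Subgraph, G.IsPathDecomposition D ∧ D.card = k}

theorem exists_isPathDecomposition {V : Type*} [Finite V] (G : SimpleGraph V) :
    ∃ D : Finset G.Subgraph, G.IsPathDecomposition D := by
  classical
  have hfin : {P : G.Subgraph | ∃ (u v : V) (h : G.Adj u v), P = G.subgraphOfAdj h}.Finite :=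
    Set.toFinite _
  refine ⟨hfin.toFinset, ?_, ?_, ?_⟩
  · intro P hP
    obtain ⟨u, v, h, rfl⟩ := hfin.mem_toFinset.1 hP
    exact ⟨u, v, h.toWalk, Walk.IsPath.of_adj h, by simp⟩
  · intro P hP Q hQ hne
    obtain ⟨u, v, h, rfl⟩ := hfin.mem_toFinset.1 hP
    obtain ⟨u', v', h', rfl⟩ := hfin.mem_toFinset.1 hQ
    rw [Set.disjoint_left]
    intro e he he'
    simp only [edgeSet_subgraphOfAdj, Set.mem_singleton_iff] at he he'
    apply hne
    have huv : s(u, v) = s(u', v') := he.symm.trans he'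
    rcases Sym2.eq_iff.1 huv with ⟨rfl, rfl⟩ | ⟨rfl, rfl⟩
    · rfl
    · exact subgraphOfAdj_symm h'
  · intro e
    induction e with
    | _ u v =>
      intro he
      have h : G.Adj u v := he
      exact ⟨G.subgraphOfAdj h, hfin.mem_toFinset.2 ⟨u, v, h, rfl⟩,
        by rw [edgeSet_subgraphOfAdj]; exact Set.mem_singleton _⟩

theorem isLeast_pathDecompositionNumber {V : Type*} [Finite V] (G : SimpleGraph V) :
    IsLeast {k : ℕ | ∃ D : Finset G.Subgraph, G.IsPathDecomposition D ∧ D.card = k}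
      G.pathDecompositionNumber := by
  obtain ⟨D, hD⟩ := G.exists_isPathDecomposition
  exact ⟨Nat.sInf_mem ⟨D.card, D, hD, rfl⟩, fun k hk => Nat.sInf_le hk⟩

end SimpleGraph

/-
If every vertex `v` of a graph has at most two ends of paths in some path decomposition (a path
consisting of `v` alone counting for two), the paths can be oriented and one-vertex paths be added
in such a way that exactly one path `Q v` finishes at each vertex `v` and at most two start there.
By Lovász's theorem the second factor `H` has such a decomposition, while a tree `T` has one in
which every vertex is an end of at most one path.

Assign every vertex of `T` to a path through it, namely to the path ending there if there is one,
and let `S` be the set of vertices assigned to a path `R`. Sweep along `R` with one active path at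
each of the `n` vertices of `H`. Arriving at a vertex `t` of `S`, extend the active path at `(t, v)`
by the copy of `Q v`, so that its new end is the start of `Q v`. At most half of the active paths
now have to be finished in order that at most one is left at each vertex; where none is left, a new
one begins. The two ends of `R` belong to `S`. Nothing need be finished at either of them, which
compensates for the `n` paths active in the end, so at most `n * |S| / 2` paths are used altogether.
-/
namespace PathFamily

open SimpleGraph

variable {V W : Type*}

/-- The edges traversed by a walk given as its list of vertices. -/
def pathEdges (l : List V) : Multiset (Sym2 V) :=
  (List.zipWith (s(·, ·)) l l.tail : List (Sym2 V))

@[simp] theorem pathEdges_nil : pathEdges ([] : List V) = 0 := rfl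

@[simp] theorem pathEdges_singleton (a : V) : pathEdges [a] = 0 := rfl

@[simp] theorem pathEdges_cons_cons (a b : V) (l : List V) :
    pathEdges (a :: b :: l) = s(a, b) ::ₘ pathEdges (b :: l) := rfl

theorem pathEdges_append {l : List V} {a : V} (h : l.getLast? = some a) (b : V) (r : List V) :
    pathEdges (l ++ b :: r) = s(a, b) ::ₘ (pathEdges l + pathEdges (b :: r)) := by
  induction l with
  | nil => simp at h
  | cons c l ih =>
    cases l with
    | nil => simp_all
    | cons d l =>
      have ih := ih (by simpa using h)
      simp only [List.cons_append, pathEdges_cons_cons] at ih ⊢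
      rw [ih, Multiset.cons_swap, Multiset.cons_add]

@[simp] theorem pathEdges_reverse (l : List V) : pathEdges l.reverse = pathEdges l := by
  induction l with
  | nil => rfl
  | cons a l ih =>
    cases l with
    | nil => rfl
    | cons b l =>
      rw [List.reverse_cons, pathEdges_append (a := b) (by simp), ih, pathEdges_cons_cons,
        Sym2.eq_swap, pathEdges_singleton, add_zero]

theorem pathEdges_map (f : V → W) (l : List V) :
    pathEdges (l.map f) = (pathEdges l).map (Sym2.map f) := by
  simp [pathEdges, ← List.map_tail, List.map_zipWith, List.zipWith_map]

theorem mem_of_mem_pathEdges {l : List V} {e : Sym2 V} (he : e ∈ pathEdges l) {v : V}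
    (hv : v ∈ e) : v ∈ l := by
  induction l with
  | nil => simp at he
  | cons a l ih =>
    cases l with
    | nil => simp at he
    | cons b l =>
      rw [pathEdges_cons_cons, Multiset.mem_cons] at he
      rcases he with rfl | he
      · rcases Sym2.mem_iff.1 hv with rfl | rfl <;> simp
      · exact List.mem_cons_of_mem _ (ih he)

theorem exists_mem_pathEdges {l : List V} {a : V} (ha : a ∈ l) (hne : l ≠ [a]) :
    ∃ e ∈ pathEdges l, a ∈ e := by
  obtain ⟨p, q, rfl⟩ := List.mem_iff_append.1 ha
  cases q with
  | cons b q =>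
    refine ⟨s(a, b), ?_, Sym2.mem_mk_left a b⟩
    rw [List.append_cons, pathEdges_append (a := a) (by simp)]
    exact Multiset.mem_cons_self _ _
  | nil =>
    obtain ⟨b, hb⟩ : ∃ b, p.getLast? = some b :=
      Option.isSome_iff_exists.1 (by simpa using fun h => hne (by simp [h]))
    exact ⟨s(b, a), by simp [pathEdges_append hb], Sym2.mem_mk_right b a⟩

theorem isChain_adj {G : SimpleGraph V} {l : List V} (hl : ∀ e ∈ pathEdges l, e ∈ G.edgeSet) :
    l.IsChain G.Adj := by
  induction l with
  | nil => exact List.isChain_nil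
  | cons a l ih =>
    cases l with
    | nil => exact List.isChain_singleton _
    | cons b l =>
      simp only [pathEdges_cons_cons, Multiset.forall_mem_cons] at hl
      exact List.isChain_cons_cons.2 ⟨hl.1, ih hl.2⟩

/-- Two lists describing the same path, traversed in the same or in the opposite direction. -/
def Reversal (l l' : List V) : Prop := l' = l ∨ l' = l.reverse

namespace Reversal

variable {l l' : List V}

theorem perm (h : Reversal l l') : l'.Perm l := by
  rcases h with rfl | rfl
  exacts [.refl _, List.reverse_perm _]

theorem ne_nil (h : Reversal l l') (hl : l ≠ []) : l' ≠ [] := by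
  rcases h with rfl | rfl <;> simpa

theorem pathEdges_eq (h : Reversal l l') : pathEdges l' = pathEdges l := by
  rcases h with rfl | rfl <;> simp

end Reversal

section Ends

variable [DecidableEq V]

/-- The number of ends of the path `l` at `v`; a one-vertex path has two ends at its vertex. -/
def endCount (v : V) (l : List V) : ℕ :=
  (if l.head? = some v then 1 else 0) + (if l.getLast? = some v then 1 else 0)

theorem endCount_singleton (v a : V) : endCount v [a] = if v = a then 2 else 0 := by
  by_cases h : a = v <;> simp [endCount, h, Ne.symm]

theorem Reversal.endCount_eq {l l' : List V} (h : Reversal l l') (v : V) :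
    endCount v l' = endCount v l := by
  rcases h with rfl | rfl <;> simp [endCount, add_comm]

theorem exists_reversal_cons {v : V} {l : List V} (h : 0 < endCount v l) :
    ∃ r, Reversal l (v :: r) := by
  by_cases h₁ : l.head? = some v
  · obtain ⟨r, rfl⟩ := List.head?_eq_some_iff.1 h₁
    exact ⟨r, .inl rfl⟩
  · have h₂ : l.reverse.head? = some v := by
      by_contra h₂
      simp_all [endCount]
    obtain ⟨r, hr⟩ := List.head?_eq_some_iff.1 h₂
    exact ⟨r, .inr hr.symm⟩

end Ends

/-- The edges traversed by the members of a family of paths. -/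
def edges (M : Multiset (List V)) : Multiset (Sym2 V) := M.bind pathEdges

@[simp] theorem edges_zero : edges (0 : Multiset (List V)) = 0 := rfl

@[simp] theorem edges_cons (l : List V) (M : Multiset (List V)) :
    edges (l ::ₘ M) = pathEdges l + edges M := Multiset.cons_bind _ _ _

@[simp] theorem edges_add (M N : Multiset (List V)) : edges (M + N) = edges M + edges N :=
  Multiset.add_bind _ _ _

theorem mem_edges {M : Multiset (List V)} {e : Sym2 V} :
    e ∈ edges M ↔ ∃ l ∈ M, e ∈ pathEdges l := Multiset.mem_bind

theorem edges_map_singleton {ι : Type*} (s : Multiset ι) (f : ι → V) :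
    edges (s.map fun i => [f i]) = 0 := by
  simp [edges, Multiset.bind_map]

theorem edges_eq_of_rel_reversal {M M' : Multiset (List V)} (h : Multiset.Rel Reversal M M') :
    edges M' = edges M := by
  induction h with
  | zero => rfl
  | cons h _ ih => simp [h.pathEdges_eq, ih]

section Ends

variable [DecidableEq V]

/-- The number of ends at `v` of the members of a family of paths. -/
def ends (M : Multiset (List V)) (v : V) : ℕ := (M.map (endCount v)).sum

@[simp] theorem ends_zero (v : V) : ends (0 : Multiset (List V)) v = 0 := rfl

@[simp] theorem ends_cons (l : List V) (M : Multiset (List V)) (v : V) :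
    ends (l ::ₘ M) v = endCount v l + ends M v := by simp [ends]

theorem ends_add (M N : Multiset (List V)) (v : V) :
    ends (M + N) v = ends M v + ends N v := by simp [ends]

theorem endCount_le_ends {M : Multiset (List V)} {l : List V} (hl : l ∈ M) (v : V) :
    endCount v l ≤ ends M v :=
  Multiset.single_le_sum (by simp) _ (Multiset.mem_map_of_mem _ hl)

theorem exists_of_ends_pos {M : Multiset (List V)} {v : V} (h : 0 < ends M v) :
    ∃ l ∈ M, 0 < endCount v l := by
  contrapose! h
  exact (Multiset.sum_eq_zero (by simpa using h)).le

theorem ends_singletons (s : Finset V) (v : V) :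
    ends (s.val.map fun z => [z]) v = if v ∈ s then 2 else 0 := by
  simp only [ends, Multiset.map_map, Function.comp_def, endCount_singleton]
  exact Finset.sum_ite_eq s v _

end Ends

section Ends

variable [DecidableEq V]

theorem endCount_append {x : V} {l r : List V} (hl : l.head? = some x) (hr : r ≠ []) (v : V) :
    endCount v (l ++ r) = (if v = x then 1 else 0) + (if r.getLast? = some v then 1 else 0) := by
  simp [endCount, hl, List.getLast?_append_of_ne_nil _ hr, eq_comm (a := v)]

theorem endCount_cons (a : V) (r : List V) (v : V) :
    endCount v (a :: r) =
      (if v = a then 1 else 0) + (if (a :: r).getLast? = some v then 1 else 0) := by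
  simp [endCount, eq_comm (a := v)]

end Ends

/-- A family of pairwise edge-disjoint paths, each given as its list of vertices. -/
structure IsPathFamily (M : Multiset (List V)) : Prop where
  nodup : ∀ l ∈ M, l.Nodup
  ne_nil : ∀ l ∈ M, l ≠ []
  nodup_edges : (edges M).Nodup

theorem IsPathFamily.of_reversal {l k : List V} {M₀ : Multiset (List V)} (h : Reversal l k)
    (hM : IsPathFamily (l ::ₘ M₀)) : IsPathFamily (k ::ₘ M₀) := by
  obtain ⟨hnd, hne, hE⟩ := hM
  simp only [Multiset.forall_mem_cons, edges_cons] at hnd hne hE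
  refine ⟨?_, ?_, by simpa [h.pathEdges_eq] using hE⟩ <;> rw [Multiset.forall_mem_cons]
  · exact ⟨h.perm.nodup_iff.2 hnd.1, hnd.2⟩
  · exact ⟨h.ne_nil hne.1, hne.2⟩

theorem IsPathFamily.of_append {z a : V} {L R : List V} {M₀ : Multiset (List V)}
    (hz : L.getLast? = some z) (hM : IsPathFamily ((L ++ a :: R) ::ₘ M₀)) :
    IsPathFamily ((a :: R) ::ₘ M₀) ∧ s(z, a) ∉ edges ((a :: R) ::ₘ M₀) := by
  obtain ⟨hnd, hne, hE⟩ := hM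
  simp only [Multiset.forall_mem_cons, edges_cons, pathEdges_append hz, Multiset.cons_add,
    Multiset.nodup_cons] at hnd hne hE
  rw [add_assoc] at hE
  refine ⟨⟨?_, ?_, ?_⟩, ?_⟩
  · exact Multiset.forall_mem_cons.2 ⟨(List.nodup_append'.1 hnd.1).2.1, hnd.2⟩
  · exact Multiset.forall_mem_cons.2 ⟨by simp, hne.2⟩
  · rw [edges_cons]
    exact (Multiset.nodup_add.1 hE.2).2.1
  · rw [edges_cons]
    exact fun h => hE.1 (Multiset.mem_add.2 (.inr h))

/-- The paths of `M` decompose the graph `G`. -/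
structure Decomposes (M : Multiset (List V)) (G : SimpleGraph V) : Prop extends
    IsPathFamily M where
  mem_edges_iff : ∀ e, e ∈ edges M ↔ e ∈ G.edgeSet

/-! ### Inserting an edge into a path family -/

section Insertion

variable [DecidableEq V]

/-- The path `k` has the same vertices as `l`, except possibly for `a`, and at least as many ends
at `a`. Thus, if a path meets `l` in an end `a` only, it can be glued to `k` there as well. -/
structure Reroutes (a : V) (l k : List V) : Prop where
  nodup : k.Nodup
  ne_nil : k ≠ []
  mem_iff : ∀ v, v ≠ a → (v ∈ k ↔ v ∈ l)
  endCount_le : endCount a l ≤ endCount a k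

/-- The family `M'` arises from `M` by rerouting its paths through the new edge `xa` in such a way
that one end moves from `x` to `a`. -/
structure InsertsEdge (x a : V) (M M' : Multiset (List V)) : Prop where
  rel : Multiset.Rel (Reroutes a) M M'
  edges_eq : edges M' = s(x, a) ::ₘ edges M
  ends_eq : ∀ v, ends M' v + (if v = x then 1 else 0) = ends M v + (if v = a then 1 else 0)

variable {x z a : V} {M₀ M' : Multiset (List V)}

theorem Reroutes.of_reversal_left {l k l' : List V} (h : Reversal l k) (hk : Reroutes a k l') :
    Reroutes a l l' where
  nodup := hk.nodup
  ne_nil := hk.ne_nil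
  mem_iff v hv := (hk.mem_iff v hv).trans h.perm.mem_iff
  endCount_le := (h.endCount_eq a).symm.trans_le hk.endCount_le

theorem Reroutes.of_reversal_right {l l' k : List V} (h : Reversal l' k) (hl : Reroutes a l l') :
    Reroutes a l k where
  nodup := h.perm.nodup_iff.2 hl.nodup
  ne_nil := h.ne_nil hl.ne_nil
  mem_iff v hv := h.perm.mem_iff.trans (hl.mem_iff v hv)
  endCount_le := hl.endCount_le.trans_eq (h.endCount_eq a).symm

theorem InsertsEdge.of_reversal {l k : List V} (h : Reversal l k)
    (hM' : InsertsEdge x a (k ::ₘ M₀) M') : InsertsEdge x a (l ::ₘ M₀) M' where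
  rel := by
    obtain ⟨b, M₁, hb, hM₁, rfl⟩ := Multiset.rel_cons_left.1 hM'.rel
    exact .cons (hb.of_reversal_left h) hM₁
  edges_eq := by simp [hM'.edges_eq, h.pathEdges_eq]
  ends_eq v := by simp [hM'.ends_eq, h.endCount_eq]

theorem insertsEdge_cons {r : List V} (hM : IsPathFamily ((x :: r) ::ₘ M₀)) (ha : a ∉ x :: r) :
    InsertsEdge x a ((x :: r) ::ₘ M₀) ((a :: x :: r) ::ₘ M₀) where
  rel := by
    refine .cons ⟨List.nodup_cons.2 ⟨ha, hM.nodup _ (by simp)⟩, by simp,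
      fun v hv => by simp [hv], ?_⟩ (Multiset.rel_refl_of_refl_on fun l hl =>
        ⟨hM.nodup l (by simp [hl]), hM.ne_nil l (by simp [hl]), fun _ _ => .rfl, le_rfl⟩)
    simp only [endCount_cons, List.getLast?_cons_cons, ↓reduceIte]
    gcongr
    split_ifs <;> simp
  edges_eq := by simp [Sym2.eq_swap]
  ends_eq v := by
    simp only [ends_cons, endCount_cons, List.getLast?_cons_cons]
    omega

/-- A path `x … z a …` with the edge `za` replaced by `xa` runs `z … x a …`, so inserting `xa` into
the original path amounts to inserting `za` back into the path `a …` that is left after `z`. -/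
theorem InsertsEdge.exists_splice {L R : List V} (hnd : (L ++ a :: R).Nodup)
    (hx : L.head? = some x) (hz : L.getLast? = some z)
    (hM' : InsertsEdge z a ((a :: R) ::ₘ M₀) M') :
    ∃ M'', InsertsEdge x a ((L ++ a :: R) ::ₘ M₀) M'' := by
  obtain ⟨b, M₁, hb, hM₁, rfl⟩ := Multiset.rel_cons_left.1 hM'.rel
  obtain ⟨R', hR'⟩ := exists_reversal_cons
    ((show 0 < endCount a (a :: R) by simp [endCount]).trans_le hb.endCount_le)
  have hreroute := hb.of_reversal_right hR'
  obtain ⟨hLnd, -, hdisj⟩ := List.nodup_append'.1 hnd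
  have hxa : x ≠ a := fun h => hdisj (List.mem_of_mem_head? hx) (by simp [h])
  have hza : z ≠ a := fun h => hdisj (List.mem_of_mem_getLast? hz) (by simp [h])
  have hz' : L.reverse.head? = some z := by simpa using hz
  refine ⟨(L.reverse ++ a :: R') ::ₘ M₁, .cons ⟨?_, by simp, fun v hv => ?_, ?_⟩ hM₁, ?_,
    fun v => ?_⟩
  · refine List.nodup_append'.2 ⟨by simpa, hreroute.nodup, fun v hvL hvR => ?_⟩
    rw [List.mem_reverse] at hvL
    have hva : v ≠ a := fun h => hdisj hvL (by simp [h])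
    exact hdisj hvL ((hreroute.mem_iff v hva).1 hvR)
  · simp only [List.mem_append, List.mem_reverse, hreroute.mem_iff v hv]
  · have := hreroute.endCount_le
    rw [endCount_cons, endCount_cons] at this
    rw [endCount_append hx (by simp), endCount_append hz' (by simp), if_neg hxa.symm,
      if_neg hza.symm]
    omega
  · have := hM'.edges_eq
    rw [edges_cons, ← hR'.pathEdges_eq, edges_cons] at this
    rw [edges_cons, edges_cons, pathEdges_append (a := x) (by simpa using hx), pathEdges_append hz,
      pathEdges_reverse, Multiset.cons_add, add_assoc, this, Multiset.add_cons, Multiset.cons_add,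
      add_assoc]
  · have := hM'.ends_eq v
    rw [ends_cons, ← hR'.endCount_eq, ends_cons, endCount_cons, endCount_cons] at this
    rw [ends_cons, ends_cons, endCount_append hx (by simp), endCount_append hz' (by simp)]
    omega

theorem exists_insertsEdge {M : Multiset (List V)} (hM : IsPathFamily M) (hxa : x ≠ a)
    (hnew : s(x, a) ∉ edges M) (hx : 0 < ends M x)
    (ha : ∀ z, s(z, a) ∈ edges M → 0 < ends M z) : ∃ M', InsertsEdge x a M M' := by
  induction hn : (M.map List.length).sum using Nat.strong_induction_on generalizing M x with
  | _ n ih =>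
  obtain ⟨l, hl, hlx⟩ := exists_of_ends_pos hx
  obtain ⟨M₀, rfl⟩ := Multiset.exists_cons_of_mem hl
  obtain ⟨r, hr⟩ := exists_reversal_cons hlx
  suffices h : ∃ M', InsertsEdge x a ((x :: r) ::ₘ M₀) M' from h.imp fun _ => .of_reversal hr
  replace hM := hM.of_reversal hr
  simp only [edges_cons, ends_cons, Multiset.map_cons, Multiset.sum_cons, ← hr.pathEdges_eq,
    ← hr.endCount_eq, ← hr.perm.length_eq] at hnew ha hn
  by_cases har : a ∈ x :: r
  swap
  · exact ⟨_, insertsEdge_cons hM har⟩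
  obtain ⟨r₁, R, rfl⟩ := List.mem_iff_append.1 (List.mem_of_ne_of_mem hxa.symm har)
  rw [← List.cons_append] at *
  obtain ⟨z, hz⟩ : ∃ z, (x :: r₁).getLast? = some z := Option.isSome_iff_exists.1 (by simp)
  have hnd := hM.nodup _ (Multiset.mem_cons_self _ _)
  have hza : z ≠ a := fun h =>
    (List.nodup_append'.1 hnd).2.2 (List.mem_of_mem_getLast? hz) (by simp [h])
  obtain ⟨hMR, hzR⟩ := hM.of_append hz
  have hends : ∀ y, s(y, a) ∈ pathEdges (x :: r₁ ++ a :: R) + edges M₀ →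
      0 < ends ((a :: R) ::ₘ M₀) y := by
    intro y hy
    have hyx : y ≠ x := fun h => hnew (h ▸ hy)
    have := ha y hy
    rw [endCount_append (x := x) rfl (by simp), if_neg hyx] at this
    rw [ends_cons, endCount_cons]
    omega
  rw [pathEdges_append hz, Multiset.cons_add, add_assoc] at hends
  have hlt : (((a :: R) ::ₘ M₀).map List.length).sum < n := by
    simp only [Multiset.map_cons, Multiset.sum_cons, ← hn, List.length_append, List.length_cons]
    omega
  obtain ⟨M', hM'⟩ := ih _ hlt hMR hza hzR (hends z (Multiset.mem_cons_self _ _)) (fun y hy =>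
    hends y (Multiset.mem_cons_of_mem (Multiset.mem_add.2 (.inr (by rwa [edges_cons] at hy))))) rfl
  exact hM'.exists_splice hnd rfl hz

end Insertion

namespace Decomposes

variable {G : SimpleGraph V} {M : Multiset (List V)}

theorem bot : Decomposes (0 : Multiset (List V)) (⊥ : SimpleGraph V) :=
  ⟨⟨by simp, by simp, by simp⟩, by simp⟩

theorem eq_singleton {a : V} {l : List V} (hM : Decomposes M G) (ha : ∀ b, ¬ G.Adj a b)
    (hl : l ∈ M) (hal : a ∈ l) : l = [a] := by
  by_contra hne
  obtain ⟨e, he, hae⟩ := exists_mem_pathEdges hal hne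
  obtain ⟨b, rfl⟩ := hae
  exact ha b ((hM.mem_edges_iff _).1 (mem_edges.2 ⟨l, hl, he⟩))

theorem add_singletons (hM : Decomposes M G) (s : Finset V) :
    Decomposes (M + s.val.map fun v => [v]) G := by
  have hE : edges (M + s.val.map fun v => [v]) = edges M := by
    rw [edges_add, edges_map_singleton, add_zero]
  refine ⟨⟨fun l hl => ?_, fun l hl => ?_, hE ▸ hM.nodup_edges⟩, hE ▸ hM.mem_edges_iff⟩
  · rcases Multiset.mem_add.1 hl with hl | hl
    · exact hM.nodup l hl
    · obtain ⟨v, -, rfl⟩ := Multiset.mem_map.1 hl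
      exact List.nodup_singleton v
  · rcases Multiset.mem_add.1 hl with hl | hl
    · exact hM.ne_nil l hl
    · obtain ⟨v, -, rfl⟩ := Multiset.mem_map.1 hl
      exact List.cons_ne_nil v []

theorem of_rel_reversal {M' : Multiset (List V)} (h : Multiset.Rel Reversal M M')
    (hM : Decomposes M G) : Decomposes M' G := by
  have hE := edges_eq_of_rel_reversal h
  have hmem : ∀ l ∈ M', ∃ k ∈ M, Reversal k l := fun l hl =>
    Multiset.exists_mem_of_rel_of_mem (Multiset.rel_flip.2 h) hl
  refine ⟨⟨fun l hl => ?_, fun l hl => ?_, hE ▸ hM.nodup_edges⟩, hE ▸ hM.mem_edges_iff⟩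
  · obtain ⟨k, hk, hkl⟩ := hmem l hl
    exact hkl.perm.nodup_iff.2 (hM.nodup k hk)
  · obtain ⟨k, hk, hkl⟩ := hmem l hl
    exact hkl.ne_nil (hM.ne_nil k hk)

variable [DecidableEq V]

theorem exists_of_deleteEdges {x a : V} (hxa : G.Adj x a)
    (hM : Decomposes M (G.deleteEdges {s(x, a)})) (ha : ∀ z, G.Adj a z → 0 < ends M z) :
    ∃ M', Decomposes M' G ∧
      ∀ v, ends M' v + (if v = x then 1 else 0) = ends M v + (if v = a then 1 else 0) := by
  have hmem := hM.mem_edges_iff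
  simp only [edgeSet_deleteEdges, Set.mem_sdiff, Set.mem_singleton_iff] at hmem
  have hnew : s(x, a) ∉ edges M := fun h => ((hmem _).1 h).2 rfl
  obtain ⟨M', hM'⟩ := exists_insertsEdge hM.toIsPathFamily hxa.ne hnew (ha x hxa.symm)
    fun z hz => ha z (((hmem _).1 hz).1 : G.Adj z a).symm
  have hpath : ∀ l ∈ M', ∃ k, Reroutes a k l := fun l hl => by
    obtain ⟨k, -, hk⟩ := Multiset.exists_mem_of_rel_of_mem (Multiset.rel_flip.2 hM'.rel) hl
    exact ⟨k, hk⟩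
  refine ⟨M', ⟨⟨fun l hl => ?_, fun l hl => ?_, ?_⟩, fun e => ?_⟩, hM'.ends_eq⟩
  · exact (hpath l hl).elim fun _ h => h.nodup
  · exact (hpath l hl).elim fun _ h => h.ne_nil
  · rw [hM'.edges_eq]
    exact Multiset.nodup_cons.2 ⟨hnew, hM.nodup_edges⟩
  · rw [hM'.edges_eq, Multiset.mem_cons, hmem]
    by_cases he : e = s(x, a)
    · simpa [he] using hxa
    · simp [he]

theorem exists_ends_fill (hM : Decomposes M G) (s : Finset V) :
    ∃ N, Decomposes N G ∧ ∀ v, ends N v = if v ∈ s ∧ ends M v = 0 then 2 else ends M v := by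
  refine ⟨_, hM.add_singletons (s.filter (ends M · = 0)), fun v => ?_⟩
  simp only [ends_add, ends_singletons, Finset.mem_filter]
  split_ifs with h
  · rw [h.2]
  · rfl

theorem exists_ends_eq_zero (hM : Decomposes M G) {a : V} (ha : ∀ b, ¬ G.Adj a b) :
    ∃ N, Decomposes N G ∧ ends N a = 0 ∧ ∀ v, ends N v ≤ ends M v := by
  have hadd : M.filter (a ∈ ·) + M.filter (a ∉ ·) = M := Multiset.filter_add_not _ M
  have hE : edges (M.filter (a ∉ ·)) = edges M := by
    have hzero : edges (M.filter (a ∈ ·)) = 0 := by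
      refine Multiset.eq_zero_of_forall_notMem fun e he => ?_
      obtain ⟨l, hl, he⟩ := mem_edges.1 he
      obtain ⟨hlM, hal⟩ := Multiset.mem_filter.1 hl
      simp [hM.eq_singleton ha hlM hal] at he
    rw [← congrArg edges hadd, edges_add, hzero, zero_add]
  refine ⟨M.filter (a ∉ ·), ⟨⟨fun l hl => ?_, fun l hl => ?_, ?_⟩, ?_⟩, ?_, fun v => ?_⟩
  · exact hM.nodup l (Multiset.mem_of_mem_filter hl)
  · exact hM.ne_nil l (Multiset.mem_of_mem_filter hl)
  · exact hE ▸ hM.nodup_edges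
  · exact hE ▸ hM.mem_edges_iff
  · by_contra h
    obtain ⟨l, hl, hpos⟩ := exists_of_ends_pos (Nat.pos_of_ne_zero h)
    obtain ⟨r, hr⟩ := exists_reversal_cons hpos
    exact (Multiset.mem_filter.1 hl).2 (hr.perm.mem_iff.1 (by simp))
  · calc ends (M.filter (a ∉ ·)) v ≤ ends (M.filter (a ∈ ·)) v + ends (M.filter (a ∉ ·)) v :=
        Nat.le_add_left _ _
      _ = ends M v := by rw [← ends_add, hadd]

end Decomposes

/-! ### Decompositions with few ends at each vertex -/

section Lovasz

variable [Finite V] [DecidableEq V]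

theorem Decomposes.exists_ends_le_of_deleteEdges {G : SimpleGraph V} {M : Multiset (List V)}
    {x a : V} (hxa : G.Adj x a) (hM : Decomposes M (G.deleteEdges {s(x, a)}))
    (hle : ∀ v, ends M v ≤ 2) (ha : ends M a ≤ 1) :
    ∃ M', Decomposes M' G ∧ (∀ v, ends M' v ≤ 2) ∧ ends M' x ≤ 1 := by
  have := Fintype.ofFinite V
  obtain ⟨N, hN, hends⟩ := hM.exists_ends_fill (Finset.univ.erase a)
  have hNle : ∀ v, ends N v ≤ 2 := fun v => by
    rw [hends]
    split_ifs
    exacts [le_rfl, hle v]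
  obtain ⟨M', hM', hends'⟩ := hN.exists_of_deleteEdges hxa fun z hz => by
    rw [hends]
    split_ifs with h
    · exact two_pos
    · simpa [hz.ne', Nat.pos_iff_ne_zero] using h
  have hne := hxa.ne
  exact ⟨M', hM', fun v => by grind, by grind⟩

/-- The first bound is Lovász's theorem on path decompositions. The second one makes its proof by
induction work: it is applied to `G` minus an edge `ax` and the vertex `x`. -/
theorem exists_decomposes_ends_le (G : SimpleGraph V) (a : V) :
    ∃ M, Decomposes M G ∧ (∀ v, ends M v ≤ 2) ∧ ends M a ≤ 1 := by
  induction hn : G.edgeSet.ncard using Nat.strong_induction_on generalizing G a with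
  | _ n ih =>
  have hadj : ∀ b x, G.Adj b x →
      ∃ M, Decomposes M G ∧ (∀ v, ends M v ≤ 2) ∧ ends M b ≤ 1 := by
    intro b x hbx
    have hlt : (G.deleteEdges {s(b, x)}).edgeSet.ncard < n := by
      rw [edgeSet_deleteEdges, ← hn]
      exact Set.ncard_sdiff_singleton_lt_of_mem hbx
    obtain ⟨M, hM, hle, hx⟩ := ih _ hlt _ x rfl
    exact hM.exists_ends_le_of_deleteEdges hbx hle hx
  by_cases ha : ∃ x, G.Adj a x
  · exact ha.elim (hadj a)
  · obtain ⟨M, hM, hle⟩ : ∃ M, Decomposes M G ∧ ∀ v, ends M v ≤ 2 := by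
      rcases eq_or_ne G ⊥ with rfl | hG
      · exact ⟨0, .bot, by simp⟩
      · obtain ⟨b, x, hbx⟩ := ne_bot_iff_exists_adj.1 hG
        exact (hadj b x hbx).imp fun M h => ⟨h.1, h.2.1⟩
    obtain ⟨N, hN, hNa, hNle⟩ := hM.exists_ends_eq_zero (not_exists.1 ha)
    exact ⟨N, hN, fun v => (hNle v).trans (hle v), by omega⟩

end Lovasz

theorem exists_leaf [Finite V] {G : SimpleGraph V} (hG : G.IsAcyclic) (hne : G ≠ ⊥) :
    ∃ u v, G.Adj u v ∧ ∀ x, G.Adj u x → x = v := by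
  obtain ⟨a, b, hab⟩ := ne_bot_iff_exists_adj.1 hne
  have : Nonempty V := ⟨a⟩
  have := Fintype.ofFinite G.edgeSet
  obtain ⟨u, v, p, hp, hmax⟩ := Walk.exists_isPath_forall_isPath_length_le_length G
  have hnil : ¬ p.Nil := fun h => by
    simpa [Walk.length_eq_zero_iff.2 h] using hmax a b hab.toWalk (.of_adj hab)
  refine ⟨u, p.snd, p.adj_snd hnil, fun x hx => hG.eq_snd_of_adj_start hp hx ?_⟩
  by_contra hxp
  have := hmax _ _ _ (hp.cons (h := hx.symm) hxp)
  rw [Walk.length_cons] at this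
  omega

theorem exists_decomposes_of_isAcyclic [Finite V] [DecidableEq V] {G : SimpleGraph V}
    (hG : G.IsAcyclic) : ∃ F, Decomposes F G ∧ ∀ t, ends F t ≤ 1 := by
  induction hn : G.edgeSet.ncard using Nat.strong_induction_on generalizing G with
  | _ n ih =>
  rcases eq_or_ne G ⊥ with rfl | hne
  · exact ⟨0, .bot, by simp⟩
  obtain ⟨u, v, huv, hleaf⟩ := exists_leaf hG hne
  have hlt : (G.deleteEdges {s(v, u)}).edgeSet.ncard < n := by
    rw [edgeSet_deleteEdges, ← hn]
    exact Set.ncard_sdiff_singleton_lt_of_mem huv.symm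
  obtain ⟨F₀, hF₀, hF₀le⟩ := ih _ hlt (hG.anti (G.deleteEdges_le _)) rfl
  obtain ⟨F, hF, hFu, hFle⟩ := hF₀.exists_ends_eq_zero (a := u) fun b hb => by
    rw [deleteEdges_adj] at hb
    exact hb.2 (by rw [hleaf b hb.1, Sym2.eq_swap]; rfl)
  obtain ⟨N, hN, hends⟩ := hF.exists_ends_fill {v}
  simp only [Finset.mem_singleton] at hends
  obtain ⟨F', hF', hends'⟩ := hN.exists_of_deleteEdges huv.symm fun z hz => by
    rw [hleaf z hz, hends]
    split_ifs with h
    · exact two_pos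
    · simpa [Nat.pos_iff_ne_zero] using h
  refine ⟨F', hF', fun t => ?_⟩
  have h₁ := (hFle t).trans (hF₀le t)
  have h₂ := hends' t
  have h₃ := hends t
  have := huv.ne
  split_ifs at h₂ h₃ <;> grind

/-! ### Orienting path families -/

instance : IsTrans (List V) Reversal where
  trans := by
    rintro a _ _ (rfl | rfl) (rfl | rfl) <;> simp [Reversal]

/-- The directions in which the lists of `M` traverse their paths are chosen in such a way that the
paths start at distinct vertices and finish at distinct vertices. -/
structure IsOriented (M : Multiset (List V)) : Prop where
  nodup_head : (M.map List.head?).Nodup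
  nodup_getLast : (M.map List.getLast?).Nodup

theorem exists_eq_cons_cons_of_not_nodup_map {α β : Type*} {f : α → β} {M : Multiset α}
    (h : ¬ (M.map f).Nodup) : ∃ a b N, M = a ::ₘ b ::ₘ N ∧ f a = f b := by
  classical
  simp only [Multiset.nodup_iff_ne_cons_cons, not_forall, not_not] at h
  obtain ⟨c, t, h⟩ := h
  obtain ⟨a, ha, rfl, h⟩ := (Multiset.map_eq_cons _ _ _ _).2 h
  obtain ⟨b, hb, hba, -⟩ := (Multiset.map_eq_cons _ _ _ _).2 h
  exact ⟨a, b, (M.erase a).erase b, by rw [Multiset.cons_erase hb, Multiset.cons_erase ha],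
    hba.symm⟩

theorem forall_ne_nil_of_rel_reversal {M M' : Multiset (List V)}
    (h : Multiset.Rel Reversal M M') (hM : ∀ l ∈ M, l ≠ []) : ∀ l ∈ M', l ≠ [] := by
  intro l hl
  obtain ⟨k, hk, hkl⟩ := Multiset.exists_mem_of_rel_of_mem (Multiset.rel_flip.2 h) hl
  exact Reversal.ne_nil hkl (hM k hk)

theorem exists_rel_reversal_of_not_isOriented {M : Multiset (List V)} (hne : ∀ l ∈ M, l ≠ [])
    (hM : ¬ IsOriented M) :
    ∃ v r₁ r₂ N, Multiset.Rel Reversal M ((v :: r₁) ::ₘ (v :: r₂) ::ₘ N) := by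
  have of_head : ∀ M' : Multiset (List V), Multiset.Rel Reversal M M' →
      ¬ (M'.map List.head?).Nodup →
        ∃ v r₁ r₂ N, Multiset.Rel Reversal M ((v :: r₁) ::ₘ (v :: r₂) ::ₘ N) := by
    intro M' hMM' hnd
    obtain ⟨l₁, l₂, N, rfl, heq⟩ := exists_eq_cons_cons_of_not_nodup_map hnd
    obtain ⟨v, r₁, rfl⟩ := List.exists_cons_of_ne_nil
      (forall_ne_nil_of_rel_reversal hMM' hne l₁ (by simp))
    obtain ⟨r₂, rfl⟩ := List.head?_eq_some_iff.1 heq.symm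
    exact ⟨v, r₁, r₂, N, hMM'⟩
  by_cases h : (M.map List.head?).Nodup
  · refine of_head (M.map List.reverse) (Multiset.rel_map_right.2
      (Multiset.rel_refl_of_refl_on fun _ _ => .inr rfl)) fun h' => hM ⟨h, ?_⟩
    simpa [Multiset.map_map, Function.comp_def] using h'
  · exact of_head M (Multiset.rel_refl_of_refl_on fun _ _ => .inl rfl) h

section Ends

variable [DecidableEq V]

theorem ends_eq_of_rel_reversal {M M' : Multiset (List V)} (h : Multiset.Rel Reversal M M')
    (v : V) : ends M' v = ends M v := by
  induction h with
  | zero => rfl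
  | cons h _ ih => simp [h.endCount_eq, ih]

theorem getLast?_ne_of_ends_le {M : Multiset (List V)} {v : V} {r₁ r₂ : List V}
    (h : ends ((v :: r₁) ::ₘ (v :: r₂) ::ₘ M) v ≤ 2) :
    (v :: r₁).getLast? ≠ some v ∧ (v :: r₂).getLast? ≠ some v ∧
      ∀ l ∈ M, l.head? ≠ some v ∧ l.getLast? ≠ some v := by
  simp only [ends_cons, endCount_cons, ↓reduceIte] at h
  have hzero : ends M v = 0 := by omega
  refine ⟨fun h₁ => by rw [if_pos h₁] at h; omega,
    fun h₂ => by rw [if_pos h₂] at h; omega, fun l hl => ?_⟩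
  have := (endCount_le_ends hl v).trans_eq hzero
  unfold endCount at this
  split_ifs at this <;> simp_all

theorem IsOriented.unglue {M : Multiset (List V)} {v : V} {r₁ r₂ : List V}
    (hM : IsOriented (((v :: r₁).reverse ++ v :: r₂) ::ₘ M))
    (hv : ends ((v :: r₁) ::ₘ (v :: r₂) ::ₘ M) v ≤ 2) :
    IsOriented ((v :: r₁).reverse ::ₘ (v :: r₂) ::ₘ M) := by
  obtain ⟨h₁, h₂, hN⟩ := getLast?_ne_of_ends_le hv
  obtain ⟨hh, hl⟩ := hM
  rw [Multiset.map_cons, Multiset.nodup_cons] at hh hl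
  rw [List.head?_append_of_ne_nil _ (by simp), List.head?_reverse] at hh
  rw [List.getLast?_append_of_ne_nil _ (by simp)] at hl
  constructor <;> simp only [Multiset.map_cons, Multiset.nodup_cons, Multiset.mem_cons, not_or,
    List.head?_reverse, List.getLast?_reverse]
  · exact ⟨⟨h₁, hh.1⟩, by simpa using fun l hl => (hN l hl).1, hh.2⟩
  · exact ⟨⟨h₂.symm, by simpa using fun l hl => (hN l hl).2⟩, hl⟩

/-- Viewed as edges joining their two ends, the paths form a multigraph of maximum degree two, which
has an orientation with all in- and outdegrees at most one: contract two paths that start at a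
common vertex into a single one. -/
theorem exists_isOriented {M : Multiset (List V)} (hne : ∀ l ∈ M, l ≠ [])
    (hM : ∀ v, ends M v ≤ 2) : ∃ M', Multiset.Rel Reversal M M' ∧ IsOriented M' := by
  induction hn : M.card using Nat.strong_induction_on generalizing M with
  | _ n ih =>
  by_cases hor : IsOriented M
  · exact ⟨M, Multiset.rel_refl_of_refl_on fun _ _ => .inl rfl, hor⟩
  obtain ⟨v, r₁, r₂, N, hrel⟩ := exists_rel_reversal_of_not_isOriented hne hor
  have hends := fun u => (ends_eq_of_rel_reversal hrel u).trans_le (hM u)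
  obtain ⟨N', hN', hor'⟩ := ih (N.card + 1) (by simp [← hn, Multiset.card_eq_card_of_rel hrel])
    (M := ((v :: r₁).reverse ++ v :: r₂) ::ₘ N) (fun l hl => by
      rcases Multiset.mem_cons.1 hl with rfl | hl
      · simp
      · exact forall_ne_nil_of_rel_reversal hrel hne l (by simp [hl])) (fun u => by
      have := hends u
      simp only [ends_cons, endCount_cons] at this
      rw [ends_cons, endCount, List.head?_append_of_ne_nil _ (by simp), List.head?_reverse,
        List.getLast?_append_of_ne_nil _ (by simp)]
      omega) (by simp)
  obtain ⟨l, N₂, hl, hN₂, rfl⟩ := Multiset.rel_cons_left.1 hN'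
  have hv : ends ((v :: r₁) ::ₘ (v :: r₂) ::ₘ N₂) v ≤ 2 := by
    simpa [ends_eq_of_rel_reversal hN₂] using hends v
  rcases hl with rfl | rfl
  · exact ⟨_, hrel.trans _ (.cons (.inr rfl) (.cons (.inl rfl) hN₂)), hor'.unglue hv⟩
  · refine ⟨_, hrel.trans _ (.cons (.inl rfl) (.cons (.inr rfl) hN₂)), ?_⟩
    rw [Multiset.cons_swap]
    refine IsOriented.unglue ?_ (by rwa [Multiset.cons_swap])
    simpa using hor'

end Ends

theorem exists_map_univ_eq [Fintype V] {M : Multiset (List V)} (hne : ∀ l ∈ M, l ≠ [])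
    (hnd : (M.map List.getLast?).Nodup) (hM : ∀ v, some v ∈ M.map List.getLast?) :
    ∃ Q : V → List V, Finset.univ.val.map Q = M ∧ ∀ v, (Q v).getLast? = some v := by
  simp only [Multiset.mem_map] at hM
  choose Q hQM hQ using hM
  refine ⟨Q, (Multiset.Nodup.ext ?_ (hnd.of_map _)).2 fun l => ?_, hQ⟩
  · exact Finset.univ.nodup.map fun v w h => Option.some_injective _ (by rw [← hQ v, h, hQ w])
  · simp only [Multiset.mem_map, Finset.mem_val, Finset.mem_univ, true_and]
    refine ⟨fun ⟨v, hv⟩ => hv ▸ hQM v, fun hl => ?_⟩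
    obtain ⟨v, hv⟩ : ∃ v, l.getLast? = some v :=
      Option.isSome_iff_exists.1 (by simpa using hne l hl)
    exact ⟨v, Multiset.inj_on_of_nodup_map hnd _ (hQM v) _ hl ((hQ v).trans hv.symm)⟩

/-- A choice of one path finishing at each vertex, at most two of which start at any given
vertex. -/
structure IsRooted [Fintype V] [DecidableEq V] (Q : V → List V) : Prop where
  nodup : ∀ v, (Q v).Nodup
  getLast?_eq : ∀ v, (Q v).getLast? = some v
  card_head_le : ∀ v, (Finset.univ.filter fun w => (Q w).head? = some v).card ≤ 2

theorem exists_isRooted [Fintype V] [DecidableEq V] (G : SimpleGraph V) :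
    ∃ Q : V → List V, IsRooted Q ∧ Decomposes (Finset.univ.val.map Q) G := by
  obtain ⟨M₀, hM₀, hends⟩ : ∃ M, Decomposes M G ∧ ∀ v, ends M v ≤ 2 := by
    rcases isEmpty_or_nonempty V with _ | ⟨⟨a⟩⟩
    · exact ⟨0, Subsingleton.elim ⊥ G ▸ .bot, by simp⟩
    · exact (exists_decomposes_ends_le G a).imp fun M h => ⟨h.1, h.2.1⟩
  obtain ⟨M, hrel, hor⟩ := exists_isOriented hM₀.ne_nil hends
  have hM := hM₀.of_rel_reversal hrel
  set S := Finset.univ.filter fun v => some v ∉ M.map List.getLast? with hS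
  have hN := hM.add_singletons S
  obtain ⟨Q, hQN, hQ⟩ := exists_map_univ_eq hN.ne_nil
    (by
      rw [Multiset.map_add, Multiset.map_map, Multiset.nodup_add]
      refine ⟨hor.nodup_getLast, S.nodup.map fun v w h => by simpa using h, ?_⟩
      rw [Multiset.disjoint_right]
      intro o ho
      obtain ⟨v, hv, rfl⟩ := Multiset.mem_map.1 ho
      exact (Finset.mem_filter.1 hv).2)
    (fun v => by
      rw [Multiset.map_add, Multiset.mem_add, or_iff_not_imp_left]
      exact fun hv => Multiset.mem_map.2
        ⟨[v], Multiset.mem_map_of_mem _ (by simpa [hS] using hv), rfl⟩)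
  rw [← hQN] at hN
  refine ⟨Q, ⟨fun v => hN.nodup _ (Multiset.mem_map_of_mem Q (Finset.mem_univ_val v)), hQ,
    fun v => ?_⟩, hN⟩
  calc (Finset.univ.filter fun w => (Q w).head? = some v).card
      = ((Finset.univ.val.map Q).map List.head?).count (some v) := by
        simp only [Multiset.map_map, Multiset.count_map, Function.comp_apply, eq_comm (a := some v)]
        rfl
    _ = (M.map List.head?).count (some v) + (S.val.map some).count (some v) := by
        rw [hQN, Multiset.map_add, Multiset.count_add, Multiset.map_map]
        rfl
    _ ≤ 1 + 1 := add_le_add (Multiset.nodup_iff_count_le_one.1 hor.nodup_head _)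
        (Multiset.nodup_iff_count_le_one.1 (S.nodup.map (Option.some_injective V)) _)

theorem edges_map {ι : Type*} (s : Finset ι) (A : ι → List V) :
    edges (s.val.map A) = ∑ i ∈ s, pathEdges (A i) := by
  simp only [edges, Multiset.bind_map]
  rfl

theorem map_edges (f : V → W) (M : Multiset (List V)) :
    (edges M).map (Sym2.map f) = edges (M.map (List.map f)) := by
  simp [edges, Multiset.map_bind, Multiset.bind_map, pathEdges_map]

theorem exists_section_of_card_fiber_le [Fintype W] [DecidableEq W] {f : W → W} {k : ℕ}
    (hf : ∀ v, (Finset.univ.filter fun w => f w = v).card ≤ k) :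
    ∃ (I : Finset W) (g : W → W), (∀ v ∈ I, f (g v) = v) ∧ Fintype.card W ≤ k * I.card := by
  have hfg : ∀ v, ∃ w, v ∈ Finset.univ.image f → f w = v := fun v => by
    by_cases hv : v ∈ Finset.univ.image f
    · obtain ⟨w, -, hw⟩ := Finset.mem_image.1 hv
      exact ⟨w, fun _ => hw⟩
    · exact ⟨v, fun h => absurd h hv⟩
  choose g hg using hfg
  exact ⟨_, g, hg, Finset.card_le_mul_card_image Finset.univ k fun v _ => hf v⟩

/-! ### Sweeping along a path of the first factor -/

section Bundle

variable [Fintype W] {t : V} {l : List V} {f : W → W}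

/-- Disjoint copies of the edges `E` at every vertex of `W` and of the edges `E'` at the vertices in
`S`. Taking `S` to be everything yields the edges of a box product. -/
def productEdges (E : Multiset (Sym2 V)) (S : Finset V) (E' : Multiset (Sym2 W)) :
    Multiset (Sym2 (V × W)) :=
  ∑ w, E.map (Sym2.map (·, w)) + ∑ v ∈ S, E'.map (Sym2.map (Prod.mk v))

theorem productEdges_cons_cons (t' t : V) (l : List V) (S : Finset V) (E : Multiset (Sym2 W)) :
    productEdges (pathEdges (t' :: t :: l)) S E =
      ∑ w, {s((t', w), (t, w))} + productEdges (pathEdges (t :: l)) S E := by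
  simp [productEdges, ← Multiset.singleton_add, Finset.sum_add_distrib, add_assoc]

theorem productEdges_eq_add_erase [DecidableEq V] {t : V} {S : Finset V} (ht : t ∈ S)
    (E : Multiset (Sym2 V)) (E' : Multiset (Sym2 W)) :
    productEdges E S E' = E'.map (Sym2.map (Prod.mk t)) + productEdges E (S.erase t) E' := by
  rw [productEdges, ← Finset.add_sum_erase S _ ht, add_left_comm, productEdges]

/-- Paths in `V × W` lying over the path `t :: l` of `V`: active ones `active w`, starting at
`(t, f w)` and waiting to be extended, and finished ones. -/
structure Bundle (t : V) (l : List V) (f : W → W) where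
  active : W → List (V × W)
  finished : Multiset (List (V × W))
  nodup_active : ∀ w, (active w).Nodup
  head?_active : ∀ w, (active w).head? = some (t, f w)
  fst_mem : ∀ w, ∀ p ∈ active w, p.1 ∈ t :: l
  isPath_finished : ∀ p ∈ finished, p.Nodup ∧ p ≠ []

namespace Bundle

/-- All paths of a bundle, active or finished. -/
def paths (B : Bundle t l f) : Multiset (List (V × W)) := Finset.univ.val.map B.active + B.finished

theorem edges_paths (B : Bundle t l f) :
    edges B.paths = ∑ w, pathEdges (B.active w) + edges B.finished := by
  rw [paths, edges_add, edges_map]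

omit [Fintype W] in
theorem active_ne_nil (B : Bundle t l f) (w : W) : B.active w ≠ [] := fun h => by
  simpa [h] using B.head?_active w

theorem isPath (B : Bundle t l f) : ∀ p ∈ B.paths, p.Nodup ∧ p ≠ [] := by
  intro p hp
  rcases Multiset.mem_add.1 hp with hp | hp
  · obtain ⟨w, -, rfl⟩ := Multiset.mem_map.1 hp
    exact ⟨B.nodup_active w, B.active_ne_nil w⟩
  · exact B.isPath_finished p hp

theorem exists_extend (B : Bundle t l (id : W → W)) {t' : V} (ht' : t' ∉ t :: l) {Q : W → List W}
    (hnd : ∀ w, (Q w).Nodup) (hlast : ∀ w, (Q w).getLast? = some w)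
    (hhead : ∀ w, (Q w).head? = some (f w)) :
    ∃ B' : Bundle t' (t :: l) f, B'.finished = B.finished ∧
      edges B'.paths = ∑ w, {s((t', w), (t, w))} +
        (edges (Finset.univ.val.map Q)).map (Sym2.map (Prod.mk t')) + edges B.paths := by
  refine ⟨⟨fun w => (Q w).map (Prod.mk t') ++ B.active w, B.finished, fun w => ?_, fun w => ?_,
    fun w p hp => ?_, B.isPath_finished⟩, rfl, ?_⟩
  · refine List.nodup_append'.2
      ⟨(hnd w).map (Prod.mk_right_injective t'), B.nodup_active w, fun p hp hpB => ht' ?_⟩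
    obtain ⟨v, -, rfl⟩ := List.mem_map.1 hp
    exact B.fst_mem w _ hpB
  · simp [List.head?_append, hhead]
  · rcases List.mem_append.1 hp with hp | hp
    · obtain ⟨v, -, rfl⟩ := List.mem_map.1 hp
      exact List.mem_cons_self
    · exact List.mem_cons_of_mem _ (B.fst_mem w p hp)
  · have hw : ∀ w, pathEdges ((Q w).map (Prod.mk t') ++ B.active w) = {s((t', w), (t, w))} +
        (pathEdges (Q w)).map (Sym2.map (Prod.mk t')) + pathEdges (B.active w) := fun w => by
      obtain ⟨r, hr⟩ := List.head?_eq_some_iff.1 (B.head?_active w)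
      rw [hr, pathEdges_append (a := (t', w)) (by simp [hlast]), pathEdges_map, add_assoc,
        Multiset.singleton_add, id]
    rw [edges_paths, edges_paths, map_edges, Multiset.map_map,
      edges_map]
    simp only [hw, Finset.sum_add_distrib, Function.comp_apply, pathEdges_map, add_assoc]

/-- For each `v` in the range of `f` one path starting at `(t, v)` remains active. As `f` takes
every value at most twice, at most half of the active paths are finished in this way. -/
theorem exists_recycle [DecidableEq W] (B : Bundle t l f)
    (hf : ∀ v, (Finset.univ.filter fun w => f w = v).card ≤ 2) :
    ∃ B' : Bundle t l (id : W → W), edges B'.paths = edges B.paths ∧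
      2 * B'.finished.card ≤ 2 * B.finished.card + Fintype.card W := by
  obtain ⟨I, g, hg, hcard⟩ := exists_section_of_card_fiber_le hf
  have hinj : Set.InjOn g I := fun x hx y hy hxy => by rw [← hg x hx, hxy, hg y hy]
  refine ⟨⟨fun v => if v ∈ I then B.active (g v) else [(t, v)],
    B.finished + (I.image g)ᶜ.val.map B.active, fun v => ?_, fun v => ?_, fun v p hp => ?_,
    fun p hp => ?_⟩, ?_, ?_⟩
  · split_ifs
    exacts [B.nodup_active _, List.nodup_singleton _]
  · split_ifs with hv
    · rw [B.head?_active, hg v hv, id]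
    · rfl
  · split_ifs at hp
    · exact B.fst_mem _ p hp
    · simp [List.mem_singleton.1 hp]
  · refine B.isPath p ((Multiset.mem_add.1 hp).elim (fun hp => Multiset.mem_add.2 (.inr hp))
      fun hp => Multiset.mem_add.2 (.inl ?_))
    exact Multiset.map_subset_map (Finset.subset_univ (I.image g)ᶜ) hp
  · have hactive : ∑ v, pathEdges (if v ∈ I then B.active (g v) else [(t, v)]) =
        ∑ w ∈ I.image g, pathEdges (B.active w) := by
      simp only [apply_ite pathEdges, pathEdges_singleton, Finset.sum_image hinj,
        Finset.sum_ite_mem, Finset.univ_inter]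
    rw [edges_paths, edges_paths, hactive, edges_add, edges_map, add_left_comm,
      Finset.sum_add_sum_compl, add_comm]
  · rw [Multiset.card_add, Multiset.card_map, Finset.card_val, Finset.card_compl,
      Finset.card_image_of_injOn hinj]
    omega

end Bundle

variable [DecidableEq W] {Q : W → List W}

theorem IsRooted.exists_head (hQ : IsRooted Q) : ∃ f : W → W,
    (∀ w, (Q w).head? = some (f w)) ∧ ∀ v, (Finset.univ.filter fun w => f w = v).card ≤ 2 := by
  have hsome : ∀ w, ∃ v, (Q w).head? = some v := fun w =>
    Option.isSome_iff_exists.1 (by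
      simpa using fun h : Q w = [] => by simpa [h] using hQ.getLast?_eq w)
  choose f hf using hsome
  exact ⟨f, hf, fun v => by simpa [hf] using hQ.card_head_le v⟩

theorem IsRooted.exists_bundle_nil (hQ : IsRooted Q) (t : V) :
    ∃ B : Bundle t [] (id : W → W), B.finished = 0 ∧
      edges B.paths = productEdges 0 {t} (edges (Finset.univ.val.map Q)) := by
  refine ⟨⟨fun w => ((Q w).map (Prod.mk t)).reverse, 0, fun w => ?_, fun w => ?_, fun w p hp => ?_,
    by simp⟩, rfl, ?_⟩
  · exact List.nodup_reverse.2 ((hQ.nodup w).map (Prod.mk_right_injective t))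
  · simp [hQ.getLast?_eq]
  · obtain ⟨v, -, rfl⟩ := List.mem_map.1 (List.mem_reverse.1 hp)
    exact List.mem_cons_self
  · rw [Bundle.edges_paths, productEdges, Finset.sum_singleton, map_edges, Multiset.map_map,
      edges_map]
    simp

variable [DecidableEq V]

theorem IsRooted.exists_extend {t' : V} {S : Finset V} (hQ : IsRooted Q)
    (ht' : t' ∉ t :: l) (hS : t' ∈ S) (B : Bundle t l (id : W → W))
    (hB : edges B.paths =
      productEdges (pathEdges (t :: l)) (S.erase t') (edges (Finset.univ.val.map Q))) :
    ∃ (f : W → W) (B' : Bundle t' (t :: l) f),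
      (∀ v, (Finset.univ.filter fun w => f w = v).card ≤ 2) ∧ B'.finished = B.finished ∧
      edges B'.paths =
        productEdges (pathEdges (t' :: t :: l)) S (edges (Finset.univ.val.map Q)) := by
  obtain ⟨f, hf, hfib⟩ := hQ.exists_head
  obtain ⟨B', hfin, hE⟩ := B.exists_extend ht' hQ.nodup hQ.getLast?_eq hf
  refine ⟨f, B', hfib, hfin, ?_⟩
  rw [hE, hB, productEdges_cons_cons, productEdges_eq_add_erase hS, add_assoc]

omit [DecidableEq V] in
theorem IsRooted.exists_bundle (hQ : IsRooted Q) {t : V} {l : List V} (hnd : (t :: l).Nodup)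
    {S : Finset V} (hS : ∀ s ∈ S, s ∈ t :: l) (hlast : ∀ s, (t :: l).getLast? = some s → s ∈ S) :
    ∃ B : Bundle t l (id : W → W),
      edges B.paths = productEdges (pathEdges (t :: l)) S (edges (Finset.univ.val.map Q)) ∧
      2 * B.finished.card + Fintype.card W ≤ Fintype.card W * S.card := by
  classical
  induction l generalizing t S with
  | nil =>
    obtain rfl : S = {t} := Finset.eq_singleton_iff_unique_mem.2
      ⟨hlast t rfl, fun s hs => List.mem_singleton.1 (hS s hs)⟩
    obtain ⟨B, hfin, hB⟩ := hQ.exists_bundle_nil t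
    exact ⟨B, hB, by simp [hfin]⟩
  | cons t₂ l ih =>
    obtain ⟨ht, hnd⟩ := List.nodup_cons.1 hnd
    obtain ⟨B, hB, hcard⟩ := ih (S := S.erase t) hnd
      (fun s hs => List.mem_of_ne_of_mem (Finset.ne_of_mem_erase hs)
        (hS s (Finset.mem_of_mem_erase hs)))
      (fun s hs => Finset.mem_erase.2
        ⟨fun h => ht (h ▸ List.mem_of_mem_getLast? hs), hlast s (by simpa using hs)⟩)
    by_cases htS : t ∈ S
    · obtain ⟨f, B', hfib, hfin, hB'⟩ := hQ.exists_extend ht htS B hB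
      obtain ⟨B'', hE, hcard''⟩ := B'.exists_recycle hfib
      refine ⟨B'', hE.trans hB', ?_⟩
      rw [← Finset.card_erase_add_one htS, mul_add_one]
      rw [hfin] at hcard''
      omega
    · obtain ⟨B', hfin, hB'⟩ := B.exists_extend ht (Q := fun w => [w]) (f := id) (by simp) (by simp)
        (by simp)
      rw [Finset.erase_eq_of_notMem htS] at hB hcard
      refine ⟨B', ?_, hfin ▸ hcard⟩
      rw [hB', hB, productEdges_cons_cons, edges_map_singleton, Multiset.map_zero, add_zero]

/-- At the first vertex of `R` no recycling takes place, so that the `n` final active paths are paid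
for by the two ends of `R`. -/
theorem IsRooted.exists_paths (hQ : IsRooted Q) {R : List V} (hnd : R.Nodup) (hlen : 2 ≤ R.length)
    {S : Finset V} (hS : ∀ s ∈ S, s ∈ R) (hends : ∀ s, 0 < endCount s R → s ∈ S) :
    ∃ M : Multiset (List (V × W)), (∀ p ∈ M, p.Nodup ∧ p ≠ []) ∧
      edges M = productEdges (pathEdges R) S (edges (Finset.univ.val.map Q)) ∧
      2 * M.card ≤ Fintype.card W * S.card := by
  obtain ⟨t', t, l, rfl⟩ : ∃ t' t l, R = t' :: t :: l := by
    match R, hlen with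
    | t' :: t :: l, _ => exact ⟨t', t, l, rfl⟩
  obtain ⟨ht', hnd⟩ := List.nodup_cons.1 hnd
  have ht'S : t' ∈ S := hends t' (by simp [endCount])
  obtain ⟨B, hB, hcard⟩ := hQ.exists_bundle (S := S.erase t') hnd
    (fun s hs => List.mem_of_ne_of_mem (Finset.ne_of_mem_erase hs)
      (hS s (Finset.mem_of_mem_erase hs)))
    (fun s hs => Finset.mem_erase.2
      ⟨fun h => ht' (h ▸ List.mem_of_mem_getLast? hs), hends s (by simp [endCount, hs])⟩)
  obtain ⟨f, B', -, hfin, hB'⟩ := hQ.exists_extend ht' ht'S B hB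
  refine ⟨B'.paths, B'.isPath, hB', ?_⟩
  rw [Bundle.paths, Multiset.card_add, Multiset.card_map, hfin, Finset.card_val, Finset.card_univ,
    ← Finset.card_erase_add_one ht'S, mul_add_one]
  omega

end Bundle

section Product

variable [DecidableEq V]

theorem two_le_length_of_ends_le_one {F : Multiset (List V)} (hne : ∀ R ∈ F, R ≠ [])
    (hF : ∀ v, ends F v ≤ 1) : ∀ R ∈ F, 2 ≤ R.length := by
  rintro (_ | ⟨a, _ | ⟨b, R⟩⟩) hR
  · exact absurd rfl (hne _ hR)
  · have := (endCount_le_ends hR a).trans (hF a)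
    simp [endCount_singleton] at this
  · simp

theorem nodup_of_ends_le_one {F : Multiset (List V)} (hne : ∀ R ∈ F, R ≠ [])
    (hF : ∀ v, ends F v ≤ 1) : F.Nodup := by
  refine Multiset.nodup_iff_ne_cons_cons.2 ?_
  rintro (_ | ⟨a, R⟩) F' rfl
  · exact hne [] (by simp) rfl
  · have := hF a
    simp only [ends_cons, endCount_cons, ↓reduceIte] at this
    omega

theorem exists_mem_endCount_unique {F : Multiset (List V)} {v : V} (hF : ends F v ≤ 1)
    (hv : ∃ R ∈ F, v ∈ R) : ∃ R ∈ F, v ∈ R ∧ ∀ R' ∈ F, 0 < endCount v R' → R' = R := by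
  by_cases h : ∃ R ∈ F, 0 < endCount v R
  · obtain ⟨R, hR, hvR⟩ := h
    obtain ⟨r, hr⟩ := exists_reversal_cons hvR
    refine ⟨R, hR, hr.perm.mem_iff.1 List.mem_cons_self, fun R' hR' hvR' => ?_⟩
    obtain ⟨F, rfl⟩ := Multiset.exists_cons_of_mem hR
    refine (Multiset.mem_cons.1 hR').resolve_right fun hR' => ?_
    have := endCount_le_ends hR' v
    rw [ends_cons] at hF
    omega
  · push Not at h
    obtain ⟨R, hR, hvR⟩ := hv
    exact ⟨R, hR, hvR, fun R' hR' hvR' => absurd hvR' (h R' hR').not_gt⟩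

omit [DecidableEq V] in
theorem edges_sum {ι : Type*} (s : Finset ι) (M : ι → Multiset (List V)) :
    edges (∑ i ∈ s, M i) = ∑ i ∈ s, edges (M i) := by
  classical
  induction s using Finset.induction_on with
  | empty => rfl
  | insert i s hi ih => rw [Finset.sum_insert hi, Finset.sum_insert hi, edges_add, ih]

variable [Fintype V] [Fintype W]

theorem sum_productEdges_fiber {F : Finset (List V)} {r : V → List V} (hr : ∀ v, r v ∈ F)
    (E : Multiset (Sym2 W)) :
    ∑ R ∈ F, productEdges (pathEdges R) (Finset.univ.filter (r · = R)) E =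
      productEdges (edges F.val) Finset.univ E := by
  have hE : ∀ w : W, (edges F.val).map (Sym2.map (·, w)) =
      ∑ R ∈ F, (pathEdges R).map (Sym2.map (·, w)) := fun w => by
    simp only [map_edges, edges_map, pathEdges_map]
  simp only [productEdges, Finset.sum_add_distrib, hE]
  rw [Finset.sum_comm, Finset.sum_fiberwise_of_maps_to fun v _ => hr v]

variable [DecidableEq W] {Q : W → List W}

theorem IsRooted.exists_product_paths (hQ : IsRooted Q) {F : Multiset (List V)}
    (hF : IsPathFamily F) (hends : ∀ v, ends F v ≤ 1) (hcover : ∀ v, ∃ R ∈ F, v ∈ R) :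
    ∃ M : Multiset (List (V × W)), (∀ p ∈ M, p.Nodup ∧ p ≠ []) ∧
      edges M = productEdges (edges F) Finset.univ (edges (Finset.univ.val.map Q)) ∧
      2 * M.card ≤ Fintype.card W * Fintype.card V := by
  choose r hrF hvr hr using fun v => exists_mem_endCount_unique (hends v) (hcover v)
  obtain ⟨F, rfl⟩ : ∃ F' : Finset (List V), F'.val = F :=
    ⟨⟨F, nodup_of_ends_le_one hF.ne_nil hends⟩, rfl⟩
  have hpaths : ∀ R ∈ F, ∃ M : Multiset (List (V × W)), (∀ p ∈ M, p.Nodup ∧ p ≠ []) ∧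
      edges M = productEdges (pathEdges R) (Finset.univ.filter (r · = R))
        (edges (Finset.univ.val.map Q)) ∧
      2 * M.card ≤ Fintype.card W * (Finset.univ.filter (r · = R)).card := fun R hR =>
    hQ.exists_paths (hF.nodup R hR) (two_le_length_of_ends_le_one hF.ne_nil hends R hR)
      (fun v hv => (Finset.mem_filter.1 hv).2 ▸ hvr v)
      (fun v hv => Finset.mem_filter.2 ⟨Finset.mem_univ v, (hr v R hR hv).symm⟩)
  choose! M hM hME hcard using hpaths
  refine ⟨∑ R ∈ F, M R, fun p hp => ?_, ?_, ?_⟩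
  · obtain ⟨R, hR, hp⟩ := Multiset.mem_sum.1 hp
    exact hM R hR p hp
  · rw [edges_sum, Finset.sum_congr rfl hME, sum_productEdges_fiber hrF]
  · calc 2 * (∑ R ∈ F, M R).card = ∑ R ∈ F, 2 * (M R).card := by
          rw [Multiset.card_sum, Finset.mul_sum]
      _ ≤ ∑ R ∈ F, Fintype.card W * (Finset.univ.filter (r · = R)).card := Finset.sum_le_sum hcard
      _ = Fintype.card W * Fintype.card V := by
          rw [← Finset.mul_sum, ← Finset.card_eq_sum_card_fiberwise fun v _ => hrF v,
            Finset.card_univ]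

end Product

/-! ### Decompositions of box products -/

section BoxProd

variable [Fintype V] [Fintype W] {G : SimpleGraph V} {H : SimpleGraph W}
  {E : Multiset (Sym2 V)} {E' : Multiset (Sym2 W)}

theorem mem_productEdges_iff (hE : ∀ e, e ∈ E ↔ e ∈ G.edgeSet) (hE' : ∀ e, e ∈ E' ↔ e ∈ H.edgeSet)
    (e : Sym2 (V × W)) :
    e ∈ productEdges E Finset.univ E' ↔ e ∈ (G.boxProd H).edgeSet := by
  induction e with
  | _ p q =>
  obtain ⟨v, w⟩ := p
  obtain ⟨v', w'⟩ := q
  simp only [productEdges, Multiset.mem_add, Multiset.mem_sum, Multiset.mem_map, hE, hE',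
    Finset.mem_univ, true_and, Sym2.exists, Sym2.map_mk, mem_edgeSet, boxProd_adj,
    Sym2.eq_iff, Prod.mk.injEq]
  grind [G.adj_comm, H.adj_comm]

theorem nodup_sum_map {ι α β : Type*} [Fintype ι] {E : Multiset (Sym2 α)} (hE : E.Nodup)
    {f : ι → α → β} (hf : ∀ i, Function.Injective (f i)) {g : β → ι} (hg : ∀ i x, g (f i x) = i) :
    (∑ i, E.map (Sym2.map (f i))).Nodup := by
  refine Multiset.nodup_bind.2 ⟨fun i _ => hE.map (Sym2.map.injective (hf i)),
    Finset.univ.nodup.pairwise fun i _ j _ hij => ?_⟩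
  rw [Function.onFun, Multiset.disjoint_left]
  rintro _ he he'
  obtain ⟨⟨x, y⟩, -, rfl⟩ := Multiset.mem_map.1 he
  obtain ⟨e', -, h⟩ := Multiset.mem_map.1 he'
  have hx : f i x ∈ Sym2.map (f j) e' := h ▸ Sym2.mem_mk_left _ _
  obtain ⟨z, -, hz⟩ := Sym2.mem_map.1 hx
  exact hij (by rw [← hg i x, ← hz, hg])

theorem nodup_productEdges (hE : E.Nodup) (hdiag : ∀ e ∈ E, ¬e.IsDiag) (hE' : E'.Nodup) :
    (productEdges E Finset.univ E').Nodup := by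
  refine Multiset.nodup_add.2 ⟨nodup_sum_map hE Prod.mk_left_injective (g := Prod.snd) (by simp),
    nodup_sum_map hE' Prod.mk_right_injective (g := Prod.fst) (by simp), ?_⟩
  rw [Multiset.disjoint_left]
  intro e he he'
  obtain ⟨w, -, he⟩ := Multiset.mem_sum.1 he
  obtain ⟨v, -, he'⟩ := Multiset.mem_sum.1 he'
  obtain ⟨⟨a, b⟩, hab, rfl⟩ := Multiset.mem_map.1 he
  obtain ⟨⟨c, d⟩, -, hcd⟩ := Multiset.mem_map.1 he'
  refine hdiag _ hab (Sym2.mk_isDiag_iff.2 ?_)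
  change s((v, c), (v, d)) = s((a, w), (b, w)) at hcd
  grind

theorem exists_decomposes_boxProd (hG : G.IsAcyclic) (hG' : ∀ v, ∃ u, G.Adj v u)
    (H : SimpleGraph W) :
    ∃ M, Decomposes M (G.boxProd H) ∧ 2 * M.card ≤ Fintype.card W * Fintype.card V := by
  classical
  obtain ⟨Q, hQ, hQH⟩ := exists_isRooted H
  obtain ⟨F, hF, hends⟩ := exists_decomposes_of_isAcyclic hG
  have hcover : ∀ v, ∃ R ∈ F, v ∈ R := fun v => by
    obtain ⟨u, hu⟩ := hG' v
    obtain ⟨R, hR, he⟩ := mem_edges.1 ((hF.mem_edges_iff s(v, u)).2 hu)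
    exact ⟨R, hR, mem_of_mem_pathEdges he (Sym2.mem_mk_left v u)⟩
  obtain ⟨M, hM, hME, hcard⟩ := hQ.exists_product_paths hF.toIsPathFamily hends hcover
  refine ⟨M, ⟨⟨fun p hp => (hM p hp).1, fun p hp => (hM p hp).2, ?_⟩, fun e => ?_⟩, hcard⟩
  · rw [hME]
    exact nodup_productEdges hF.nodup_edges
      (fun e he => G.not_isDiag_of_mem_edgeSet ((hF.mem_edges_iff e).1 he)) hQH.nodup_edges
  · rw [hME]
    exact mem_productEdges_iff hF.mem_edges_iff hQH.mem_edges_iff e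

end BoxProd

theorem mem_edges_ofSupport {G : SimpleGraph V} {l : List V} (hne : l ≠ []) (hl : l.IsChain G.Adj)
    (e : Sym2 V) : e ∈ (Walk.ofSupport l hne hl).edges ↔ e ∈ pathEdges l := by
  rw [Walk.edges_eq_zipWith_support, Walk.support_ofSupport]
  rfl

theorem exists_isPathGraph {G : SimpleGraph V} {l : List V} (hnd : l.Nodup) (hne : l ≠ [])
    (hl : ∀ e ∈ pathEdges l, e ∈ G.edgeSet) :
    ∃ P : G.Subgraph, P.IsPathGraph ∧ ∀ e, e ∈ P.edgeSet ↔ e ∈ pathEdges l := by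
  refine ⟨(Walk.ofSupport l hne (isChain_adj hl)).toSubgraph, ⟨_, _, _, ?_, rfl⟩, fun e => ?_⟩
  · rwa [Walk.isPath_def, Walk.support_ofSupport]
  · rw [Walk.mem_edges_toSubgraph, mem_edges_ofSupport]

theorem Decomposes.exists_isPathDecomposition {G : SimpleGraph V} {M : Multiset (List V)}
    (hM : Decomposes M G) : ∃ D, G.IsPathDecomposition D ∧ D.card ≤ M.card := by
  classical
  have hsub : ∀ l ∈ M, ∃ P : G.Subgraph, P.IsPathGraph ∧ ∀ e, e ∈ P.edgeSet ↔ e ∈ pathEdges l :=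
    fun l hl => exists_isPathGraph (hM.nodup l hl) (hM.ne_nil l hl) fun e he =>
      (hM.mem_edges_iff e).1 (mem_edges.2 ⟨l, hl, he⟩)
  choose! P hP hPE using hsub
  refine ⟨M.toFinset.image P, ⟨?_, ?_, fun e he => ?_⟩,
    Finset.card_image_le.trans (Multiset.toFinset_card_le M)⟩
  · simpa using hP
  · simp only [Finset.forall_mem_image, Multiset.mem_toFinset]
    intro l hl l' hl' hne
    obtain ⟨N, rfl⟩ := Multiset.exists_cons_of_mem hl
    have hN : l' ∈ N := (Multiset.mem_cons.1 hl').resolve_left fun h => hne (h ▸ rfl)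
    have hdisj := (Multiset.nodup_add.1 (edges_cons l N ▸ hM.nodup_edges)).2.2
    exact Set.disjoint_left.2 fun e he he' => Multiset.disjoint_left.1 hdisj
      ((hPE l hl e).1 he) (mem_edges.2 ⟨l', hN, (hPE l' hl' e).1 he'⟩)
  · obtain ⟨l, hl, hel⟩ := mem_edges.1 ((hM.mem_edges_iff e).2 he)
    exact ⟨P l, Finset.mem_image_of_mem P (Multiset.mem_toFinset.2 hl), (hPE l hl e).2 hel⟩

theorem Decomposes.pathDecompositionNumber_le {G : SimpleGraph V} {M : Multiset (List V)}
    (hM : Decomposes M G) : G.pathDecompositionNumber ≤ M.card := by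
  obtain ⟨D, hD, hcard⟩ := hM.exists_isPathDecomposition
  exact le_trans (Nat.sInf_le ⟨D, hD, rfl⟩) hcard

end PathFamily

theorem corollary4p4_general {V W : Type*} [Fintype V] [Fintype W] {T : SimpleGraph V}
    (hT : T.IsAcyclic) (hT' : ∀ v, ∃ u, T.Adj v u) (H : SimpleGraph W) :
    ((T.boxProd H).pathDecompositionNumber : ℚ) ≤
      (Fintype.card V : ℚ) * (Fintype.card W : ℚ) / 2 := by
  obtain ⟨M, hM, hcard⟩ := PathFamily.exists_decomposes_boxProd hT hT' H
  have hle : 2 * (T.boxProd H).pathDecompositionNumber ≤ Fintype.card V * Fintype.card W := by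
    linarith [hM.pathDecompositionNumber_le]
  rw [le_div_iff₀' two_pos]
  exact_mod_cast hle

theorem corollary4p4 {V W : Type*} [Fintype V] [Fintype W]
    (T : SimpleGraph V) (H : SimpleGraph W) (m n : ℕ)
    (hT : T.IsTree) (hm : Fintype.card V = m) (hm2 : 2 ≤ m)
    (hH : H.Connected) (hn : Fintype.card W = n) :
    ((T.boxProd H).pathDecompositionNumber : ℚ) ≤ (m : ℚ) * (n : ℚ) / 2 := by
  subst hm hn
  have : Nontrivial V := Fintype.one_lt_card_iff_nontrivial.1 hm2
  exact corollary4p4_general hT.isAcyclic hT.connected.preconnected.exists_adj_of_nontrivial H
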